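/- Let $\mathcal M=\langle Q,A,\delta\rangle$ be a Markov decision process with finite state set $Q$, finite action set $A$ and transition function $\delta:Q\times A\to\mathcal D(Q)$, where $\mathcal D(X)$ is the set of probability distributions on $X$. Let $\mathrm{post}(q,a)$ be the support of $\delta(q,a)$. A strategy $\alpha$ maps finite paths $q_0a_0\dots q_n$ to distributions over $A$; it is pure if it always plays some action with probability $1$, and memoryless if its choice depends only on the last state $q_n$. Given an initial distribution $d_0$ and a strategy $\alpha$, let $\Pr^\alpha$ be the induced probability measure on infinite sequences $q_0a_0q_1a_1\dots$, and let $\mathcal M^\alpha_k\in\mathcal D(Q)$ be the distribution of the state $q_k$. For $T\subseteq Q$ and $d\in\mathcal D(Q)$ let $\mathit{sum}_T(d)=\sum_{q\in T}d(q)$ and $\mathit{max}_T(d)=\max_{q\in T}d(q)$ (with $\mathit{max}_\emptyset=0$). For $f\in\{\mathit{sum}_T,\mathit{max}_T\}$, a sequence $(d_i)_{i\ge 0}$ of distributions is always $p$-synchronizing according to $f$ if $f(d_i)\ge p$ for all $i\ge 0$. For the always synchronizing objective, $\mathcal M$ is sure winning from $d_0$ if for some $\alpha$ the sequence $(\mathcal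 M^\alpha_k)_k$ is always $1$-synchronizing; almost-sure winning if for some $\alpha$ it is always $(1-\varepsilon)$-synchronizing for all $\varepsilon>0$; limit-sure winning if for every $\varepsilon>0$ there is $\alpha$ such that it is always $(1-\varepsilon)$-synchronizing. The winning region of $f$ in a given mode is the set of all such $d_0$. Let $\Box T$ be the set of sequences $q_0a_0q_1a_1\dots$ with $q_i\in T$ for all $i$. For the safety objective $\Box T$, $\mathcal M$ is sure winning from $d_0$ if for some $\alpha$ every path-outcome (every infinite path with $d_0(q_0)>0$ in which each action $a_i$ has positive probability under $\alpha$) lies in $\Box T$; almost-sure winning if $\Pr^\alpha(\Box T)=1$ for some $\alpha$; limit-sure winning if $\sup_\alpha\Pr^\alpha(\Box T)=1$. Then the following hold. 1. The sure, almost-sure and limit-sure winning regions for always synchronizing according to $\mathit{sum}_T$ are all equal to the set of initial distributions that are winning for the safety objective $\Box T$, in whichever of the three modes for the safety objective. 2. The sure, almost-sure and limit-sure winning regions for always synchronizing according to $\mathit{max}_T$ are all equal to the set of Dirac distributions on states $q_0$ from which there is an infinite path $q_0a_0q_1a_1\dots$ with $q_i\in T$ and $\delta(q_i,a_i)(q_{i+1})=1$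 for all $i\ge 0$. 3. Pure memoryless strategies suffice: for $f\in\{\mathit{sum}_T,\mathit{max}_T\}$, whenever $d_0$ is winning in any of the three modes, there is a pure memoryless strategy $\alpha$ for which $(\mathcal M^\alpha_k)_k$ is always $1$-synchronizing according to $f$. 4. For each choice of $\mathit{sum}$ or $\mathit{max}$ and each of the three modes, the membership problem (given $\mathcal M$, $T$ and $d_0$, decide whether $d_0$ is in the winning region for $\mathit{sum}_T$, respectively $\mathit{max}_T$) is solvable by a Turing machine in time polynomial in the size of the input. The input is given by the number of states and the number of actions, the set $T$, the support of $d_0$, and the table of transitions $(q,a,q')$ with $q'\in\mathrm{post}(q,a)$. -/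

import Mathlib

open MeasureTheory ProbabilityTheory
open scoped ENNReal

namespace SyncMDP

universe u v

/-- A Markov decision process with state set `Q` and action set `A` (finite in the theorem):
a probabilistic transition function `δ : Q × A → 𝒟(Q)`. -/
structure MDP (Q : Type u) (A : Type v) where
  δ : Q → A → PMF Q

/-- A randomized strategy: given a finite path `q₀ a₀ q₁ a₁ … qₙ`, presented as the list
`[(q₀, a₀), …, (qₙ₋₁, aₙ₋₁)]` of past state-action pairs and the last state `qₙ`, it returns a
distribution over actions. -/
abbrev Strategy (Q : Type u) (A : Type v) := List (Q × A) → Q → PMF A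

/-- A pure strategy always plays some action with probability one. -/
def Strategy.IsPure {Q : Type u} {A : Type v} (α : Strategy Q A) : Prop :=
  ∀ ρ q, ∃ a, α ρ q a = 1

/-- A memoryless strategy depends on the last state only. -/
def Strategy.IsMemoryless {Q : Type u} {A : Type v} (α : Strategy Q A) : Prop :=
  ∀ ρ ρ' q, α ρ q = α ρ' q

/-- The three winning modes. -/
inductive Mode
  | sure
  | almostSure
  | limitSure

/-- The two ways of measuring synchronization in a target set `T`. -/
inductive SyncKind
  | sum
  | max

/-- The functions `sum_T (d) = ∑_{q ∈ T} d(q)` and `max_T (d) = max_{q ∈ T} d(q)`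
(with `max_∅ = 0`). -/
noncomputable def SyncKind.fn {Q : Type u} (T : Finset Q) : SyncKind → PMF Q → ℝ≥0∞
  | SyncKind.sum, d => ∑ q ∈ T, d q
  | SyncKind.max, d => T.sup fun q => d q

/-- A sequence of distributions is always `p`-synchronizing according to `f`. -/
def AlwaysSynchronizing {Q : Type u} (f : PMF Q → ℝ≥0∞) (p : ℝ≥0∞) (s : ℕ → PMF Q) : Prop :=
  ∀ i, p ≤ f (s i)

namespace MDP

section
variable {Q : Type u} {A : Type v}

/-- The set of possible successors of `q` under action `a`. -/
def post (M : MDP Q A) (q : Q) (a : A) : Set Q := (M.δ q a).support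

/-- The infinite paths `q₀ a₀ q₁ a₁ …`, the term of index `i` being the pair `(qᵢ, aᵢ)`. -/
def paths (M : MDP Q A) : Set (ℕ → Q × A) :=
  {π | ∀ i, (π (i + 1)).1 ∈ M.post (π i).1 (π i).2}

/-- The first `n` state-action pairs of an infinite sequence. -/
def prefixList (π : ℕ → Q × A) (n : ℕ) : List (Q × A) := List.ofFn fun i : Fin n => π i

/-- The set of path-outcomes from the initial distribution `d₀` under the strategy `α`. -/
def outcomes (M : MDP Q A) (d₀ : PMF Q) (α : Strategy Q A) : Set (ℕ → Q × A) :=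
  {π | π ∈ M.paths ∧ (π 0).1 ∈ d₀.support ∧
    ∀ i, (π i).2 ∈ (α (prefixList π i) (π i).1).support}

/-- The safety event `□ T` of always staying in `T`. -/
def safe (T : Finset Q) : Set (ℕ → Q × A) := {π | ∀ i, (π i).1 ∈ T}

/-- The law of the next state-action pair when the state is drawn from `d` and the action is then
drawn by the strategy, after the state-action pairs `ρ`. -/
noncomputable def nextPair (α : Strategy Q A) (ρ : List (Q × A)) (d : PMF Q) : PMF (Q × A) :=
  d.bind fun q => (α ρ q).map fun a => (q, a)

end

section
variable {Q : Type u} {A : Type v} [Fintype Q] [MeasurableSpace Q] [DiscreteMeasurableSpace Q]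
  [Fintype A] [MeasurableSpace A] [DiscreteMeasurableSpace A]

/-- The law of the state-action pair of index `n + 1` given the pairs of index `0, …, n`. -/
noncomputable def stepKernel (M : MDP Q A) (α : Strategy Q A) (n : ℕ) :
    Kernel (∀ _ : Finset.Iic n, Q × A) (Q × A) :=
  Kernel.ofFunOfCountable fun h =>
    (nextPair α
      (List.ofFn fun i : Fin (n + 1) => h ⟨i, Finset.mem_Iic.mpr (Nat.lt_succ_iff.mp i.2)⟩)
      (M.δ (h ⟨n, Finset.mem_Iic.mpr le_rfl⟩).1 (h ⟨n, Finset.mem_Iic.mpr le_rfl⟩).2)).toMeasure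

instance instMarkovStepKernel (M : MDP Q A) (α : Strategy Q A) (n : ℕ) :
    IsMarkovKernel (M.stepKernel α n) :=
  ⟨fun _ => PMF.toMeasure.isProbabilityMeasure _⟩

/-- The probability measure `Pr^α` on sequences of state-action pairs, from the initial
distribution `d₀`. -/
noncomputable def pathMeasure (M : MDP Q A) (d₀ : PMF Q) (α : Strategy Q A) :
    Measure (ℕ → Q × A) :=
  Kernel.trajMeasure (X := fun _ => Q × A) (nextPair α [] d₀).toMeasure (M.stepKernel α)

instance instProbPathMeasure (M : MDP Q A) (d₀ : PMF Q) (α : Strategy Q A) :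
    IsProbabilityMeasure (M.pathMeasure d₀ α) := by
  have : IsProbabilityMeasure (nextPair α [] d₀).toMeasure :=
    PMF.toMeasure.isProbabilityMeasure _
  unfold pathMeasure
  infer_instance

instance instProbStateLaw (M : MDP Q A) (d₀ : PMF Q) (α : Strategy Q A) (k : ℕ) :
    IsProbabilityMeasure ((M.pathMeasure d₀ α).map fun π => (π k).1) :=
  Measure.isProbabilityMeasure_map (measurable_fst.comp (measurable_pi_apply k)).aemeasurable

/-- The symbolic outcome: the distribution `M^α_k` over states after `k` steps. -/
noncomputable def symbolicOutcome (M : MDP Q A) (d₀ : PMF Q) (α : Strategy Q A) (k : ℕ) : PMF Q :=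
  ((M.pathMeasure d₀ α).map fun π => (π k).1).toPMF

/-- The winning region for always synchronizing according to `f`, in each winning mode. -/
def winAlways (M : MDP Q A) (f : PMF Q → ℝ≥0∞) : Mode → Set (PMF Q)
  | Mode.sure => {d₀ | ∃ α : Strategy Q A, AlwaysSynchronizing f 1 (M.symbolicOutcome d₀ α)}
  | Mode.almostSure => {d₀ | ∃ α : Strategy Q A, ∀ ε : ℝ≥0∞, 0 < ε →
      AlwaysSynchronizing f (1 - ε) (M.symbolicOutcome d₀ α)}
  | Mode.limitSure => {d₀ | ∀ ε : ℝ≥0∞, 0 < ε → ∃ α : Strategy Q A,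
      AlwaysSynchronizing f (1 - ε) (M.symbolicOutcome d₀ α)}

/-- The initial distributions from which the event `E` can be realized, in the traditional
state-based semantics, in each winning mode. -/
def winEvent (M : MDP Q A) (E : Set (ℕ → Q × A)) : Mode → Set (PMF Q)
  | Mode.sure => {d₀ | ∃ α : Strategy Q A, M.outcomes d₀ α ⊆ E}
  | Mode.almostSure => {d₀ | ∃ α : Strategy Q A, M.pathMeasure d₀ α E = 1}
  | Mode.limitSure => {d₀ | ⨆ α : Strategy Q A, M.pathMeasure d₀ α E = 1}

end

end MDP

/-- An input of the membership problem: a transition system with states `0, …, n - 1` and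
actions `0, …, m - 1`, a target set, and the support of the initial distribution. -/
structure Input where
  n : ℕ
  m : ℕ
  trans : Fin n → Fin m → Fin n → Bool
  target : Fin n → Bool
  init : Fin n → Bool

open Classical in
/-- The input that presents an MDP, a target set and an initial distribution: `(q, a, q')` is a
transition when `q' ∈ post(q, a)`. -/
noncomputable def Input.ofMDP {n m : ℕ} (M : MDP (Fin n) (Fin m)) (T : Finset (Fin n))
    (d₀ : PMF (Fin n)) : Input where
  n := n
  m := m
  trans q a q' := decide (q' ∈ M.post q a)
  target q := decide (q ∈ T)
  init q := decide (q ∈ d₀.support)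

open Computability (Γ')

/-- A finite sequence of bits as a string. -/
def bits {n : ℕ} (f : Fin n → Bool) : List Γ' := List.ofFn fun i => Γ'.bit (f i)

/-- The rows of the transition table, grouped by state; a row lists the successors of a state under
an action and ends in a comma, and the group of a state ends in a `ket`. -/
def table {n m : ℕ} (R : Fin n → Fin m → Fin n → Bool) : List Γ' :=
  (List.ofFn fun q => (List.ofFn fun a => bits (R q a) ++ [Γ'.comma]).flatten ++ [Γ'.ket]).flatten

/-- The string that encodes an input: `n` and `m` in unary, the characteristic vectors of the target
set and of the initial support, and the transition table. -/
def Input.encode (I : Input) : List Γ' :=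
  List.replicate I.n (Γ'.bit true) ++ Γ'.ket :: (List.replicate I.m (Γ'.bit true) ++ Γ'.ket ::
    (bits I.target ++ Γ'.ket :: (bits I.init ++ Γ'.ket :: table I.trans)))

theorem bits_injective {n : ℕ} {f g : Fin n → Bool} (h : bits f = bits g) : f = g := by
  have h' := List.ofFn_injective h
  funext i
  simpa using congrFun h' i

theorem split_injective {s : Γ'} : ∀ {l₁ l₂ r₁ r₂ : List Γ'}, s ∉ l₁ → s ∉ l₂ →
    l₁ ++ s :: r₁ = l₂ ++ s :: r₂ → l₁ = l₂ ∧ r₁ = r₂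
  | [], [], _, _, _, _, h => by simpa using h
  | [], x :: l₂, _, _, _, h2, h => by simp_all
  | x :: l₁, [], _, _, h1, _, h => by simp_all
  | x :: l₁, y :: l₂, _, _, h1, h2, h => by
    simp only [List.cons_append, List.cons.injEq, List.mem_cons, not_or] at h h1 h2
    obtain ⟨h3, h4⟩ := split_injective h1.2 h2.2 h.2
    exact ⟨by rw [h.1, h3], h4⟩

theorem blocks_injective {s : Γ'} : ∀ {n : ℕ} {f g : Fin n → List Γ'},
    (∀ i, s ∉ f i) → (∀ i, s ∉ g i) →
    (List.ofFn fun i => f i ++ [s]).flatten = (List.ofFn fun i => g i ++ [s]).flatten → f = g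
  | 0, _, _, _, _, _ => funext fun i => i.elim0
  | n + 1, f, g, hf, hg, h => by
    simp only [List.ofFn_succ, List.flatten_cons, List.append_assoc, List.singleton_append] at h
    obtain ⟨h1, h2⟩ := split_injective (hf 0) (hg 0) h
    have h3 := blocks_injective (fun i => hf i.succ) (fun i => hg i.succ) h2
    funext i
    refine Fin.cases h1 (fun j => congrFun h3 j) i

/-- Distinct inputs have distinct encodings. -/
theorem Input.encode_injective : Function.Injective Input.encode := by
  rintro ⟨n, m, R, T, d⟩ ⟨n', m', R', T', d'⟩ h
  simp only [Input.encode] at h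
  have hb : ∀ {k : ℕ} (f : Fin k → Bool), Γ'.ket ∉ bits f := by simp [bits, List.mem_ofFn]
  have hc : ∀ {k : ℕ} (f : Fin k → Bool), Γ'.comma ∉ bits f := by simp [bits, List.mem_ofFn]
  have hr : ∀ k : ℕ, Γ'.ket ∉ List.replicate k (Γ'.bit true) := by simp
  obtain ⟨h1, t1⟩ := split_injective (hr _) (hr _) h
  obtain ⟨h2, t2⟩ := split_injective (hr _) (hr _) t1
  obtain rfl : n = n' := by simpa using congrArg List.length h1
  obtain rfl : m = m' := by simpa using congrArg List.length h2
  obtain ⟨h3, t3⟩ := split_injective (hb _) (hb _) t2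
  obtain ⟨h4, t4⟩ := split_injective (hb _) (hb _) t3
  obtain rfl := bits_injective h3
  obtain rfl := bits_injective h4
  have hk : ∀ (R : Fin n → Fin m → Fin n → Bool) (q : Fin n),
      Γ'.ket ∉ (List.ofFn fun a => bits (R q a) ++ [Γ'.comma]).flatten := by
    intro R q
    simp only [List.mem_flatten, List.mem_ofFn, not_exists, not_and]
    rintro _ ⟨a, rfl⟩
    simpa using hb _
  have h5 := blocks_injective (hk R) (hk R') t4
  have h6 : R = R' := by
    funext q a
    have h7 := blocks_injective (fun a => hc (R q a)) (fun a => hc (R' q a)) (congrFun h5 q)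
    exact bits_injective (congrFun h7 a)
  rw [h6]

/-- The Boolean function `D` on inputs is computed by a Turing machine in time polynomial in the
length of the encoded input. -/
def PolyTime (D : Input → Bool) : Prop :=
  Nonempty (Turing.TM2ComputableInPolyTime Input.encode Computability.encodeBool D)

end SyncMDP

open SyncMDP

/-! All the winning regions come from one decreasing iteration, `region`. It starts from `T`, and a
state survives a round if some action has a successor set accepted by the current level: contained
in it for `sum`, a singleton inside it for `max`. With finitely many states, the iteration is stable
from level `Nat.card Q` on (`region_card_succ`). In every mode, a distribution wins exactly when its
support is accepted by that level (`mem_winAlways_iff`, `mem_winEvent_safe_iff`).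

Sufficiency: each state of the stable level has an action that stays acceptable. Playing it forever
is a pure memoryless strategy that wins surely, the strongest mode (`exists_pure_memoryless`).

Necessity starts from the weakest mode, limit-sure. Positive transition probabilities are bounded
below by some `p > 0`. For `sum`, if the mass outside `T` never exceeds `ε`, then the mass outside
level `r` never exceeds `c * ε`, with `c` independent of the strategy. At time 0 this mass depends
on `d₀` only, so it vanishes as `ε` tends to 0 (`support_subset_region`). For `max`, the single
value `ε = p / 4` suffices: were the transition between consecutive heavy states not deterministic,
too much mass would leak (`exists_path_of_limitSure`).

Complexity: the iteration depends on supports only. A stack machine performs it in `n + 1` passes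
over the input, each of linear length (`runs_main`, `polyTime_answer`, `answer_ofMDP`). -/

namespace SyncMDP.MDP

/-! ### The path measure and its state marginals. -/

section PathMeasure
variable {Q : Type*} {A : Type*} [Fintype Q] [MeasurableSpace Q] [DiscreteMeasurableSpace Q]
  [Fintype A] [MeasurableSpace A] [DiscreteMeasurableSpace A]

theorem mem_support_nextPair {Q A : Type*} (α : Strategy Q A) (ρ : List (Q × A)) (d : PMF Q)
    (x : Q × A) :
    x ∈ (nextPair α ρ d).support ↔ x.1 ∈ d.support ∧ x.2 ∈ (α ρ x.1).support := by
  obtain ⟨q, a⟩ := x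
  simp only [nextPair, PMF.mem_support_bind_iff, PMF.support_map, Set.mem_image, Prod.mk.injEq]
  constructor
  · rintro ⟨q', hq', a', ha', rfl, rfl⟩
    exact ⟨hq', ha'⟩
  · rintro ⟨hq, ha⟩
    exact ⟨q, hq, a, ha, rfl, rfl⟩

theorem nextPair_map_fst {Q A : Type*} (α : Strategy Q A) (ρ : List (Q × A)) (d : PMF Q) :
    (nextPair α ρ d).map Prod.fst = d := by
  simp only [nextPair, PMF.map_bind, PMF.map_comp]
  conv_rhs => rw [← PMF.bind_pure d]
  congr 1
  funext q
  exact PMF.map_const _ _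

theorem nextPair_toMeasure_preimage_fst {Q A : Type*} [MeasurableSpace Q]
    [DiscreteMeasurableSpace Q] [MeasurableSpace A] (α : Strategy Q A) (ρ : List (Q × A))
    (d : PMF Q) (S : Set Q) : (nextPair α ρ d).toMeasure (Prod.fst ⁻¹' S) = d.toMeasure S := by
  rw [← PMF.toMeasure_map_apply Prod.fst (nextPair α ρ d) S measurable_fst .of_discrete,
    nextPair_map_fst]

theorem ae_mem_support_toMeasure {X : Type*} [Countable X] [MeasurableSpace X]
    [DiscreteMeasurableSpace X] (p : PMF X) : ∀ᵐ x ∂p.toMeasure, x ∈ p.support := by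
  rw [ae_iff, PMF.toMeasure_apply_eq_zero_iff _ (MeasurableSet.of_discrete)]
  exact Set.disjoint_left.2 fun x hx hx' => hx' hx

theorem pathMeasure_map_zero (M : MDP Q A) (d₀ : PMF Q) (α : Strategy Q A) :
    (M.pathMeasure d₀ α).map (fun π => π 0) = (nextPair α [] d₀).toMeasure := by
  have h : (M.pathMeasure d₀ α).map (Preorder.frestrictLe 0) =
      (nextPair α [] d₀).toMeasure.map
        (MeasurableEquiv.piUnique (fun _ : Finset.Iic 0 => Q × A)).symm := by
    rw [pathMeasure, Kernel.trajMeasure, Measure.map_comp _ _ (by fun_prop),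
      Kernel.traj_map_frestrictLe, Kernel.partialTraj_self, Measure.id_comp]
  have h' := congrArg (Measure.map fun x : (∀ _ : Finset.Iic 0, Q × A) =>
    x ⟨0, Finset.mem_Iic.2 le_rfl⟩) h
  rw [Measure.map_map (by fun_prop) (by fun_prop), Measure.map_map (by fun_prop) (by fun_prop)] at h'
  have e : ((fun x : (∀ _ : Finset.Iic 0, Q × A) => x ⟨0, Finset.mem_Iic.2 le_rfl⟩) ∘
      (MeasurableEquiv.piUnique (fun _ : Finset.Iic 0 => Q × A)).symm) = id := by
    funext x
    rfl
  rw [e, Measure.map_id] at h'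
  exact h'

/-- The Ionescu-Tulcea property. With `pathMeasure_map_zero`, it is all that is used about the
dynamics of the path measure. -/
theorem pathMeasure_map_succ (M : MDP Q A) (d₀ : PMF Q) (α : Strategy Q A) (n : ℕ) :
    (M.pathMeasure d₀ α).map (fun π => (Preorder.frestrictLe n π, π (n + 1))) =
      (M.pathMeasure d₀ α).map (Preorder.frestrictLe n) ⊗ₘ M.stepKernel α n := by
  have : IsProbabilityMeasure (nextPair α [] d₀).toMeasure :=
    PMF.toMeasure.isProbabilityMeasure _
  exact Kernel.map_frestrictLe_trajMeasure_compProd_eq_map_trajMeasure.symm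

theorem ae_zero (M : MDP Q A) (d₀ : PMF Q) (α : Strategy Q A) :
    ∀ᵐ π ∂M.pathMeasure d₀ α, π 0 ∈ (nextPair α [] d₀).support := by
  have h := ae_mem_support_toMeasure (nextPair α [] d₀)
  rw [← M.pathMeasure_map_zero] at h
  exact ae_of_ae_map (measurable_pi_apply 0).aemeasurable h

theorem ae_succ (M : MDP Q A) (d₀ : PMF Q) (α : Strategy Q A) (n : ℕ) :
    ∀ᵐ π ∂M.pathMeasure d₀ α, π (n + 1) ∈
      (nextPair α (prefixList π (n + 1)) (M.δ (π n).1 (π n).2)).support := by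
  let S : Set ((∀ _ : Finset.Iic n, Q × A) × (Q × A)) := {x | x.2 ∈ (nextPair α
      (List.ofFn fun i : Fin (n + 1) => x.1 ⟨i, Finset.mem_Iic.mpr (Nat.lt_succ_iff.mp i.2)⟩)
      (M.δ (x.1 ⟨n, Finset.mem_Iic.mpr le_rfl⟩).1 (x.1 ⟨n, Finset.mem_Iic.mpr le_rfl⟩).2)).support}
  have h : ∀ᵐ x ∂(M.pathMeasure d₀ α).map (Preorder.frestrictLe n) ⊗ₘ M.stepKernel α n,
      x ∈ S := by
    refine (Measure.ae_compProd_iff (MeasurableSet.of_discrete (s := S))).2 ?_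
    exact ae_of_all _ fun x => ae_mem_support_toMeasure _
  rw [← M.pathMeasure_map_succ] at h
  exact ae_of_ae_map (by fun_prop) h

/-- Almost every sequence is a path-outcome. -/
theorem ae_mem_outcomes (M : MDP Q A) (d₀ : PMF Q) (α : Strategy Q A) :
    ∀ᵐ π ∂M.pathMeasure d₀ α, π ∈ M.outcomes d₀ α := by
  filter_upwards [M.ae_zero d₀ α, ae_all_iff.2 (M.ae_succ d₀ α)] with π h0 hs
  simp only [mem_support_nextPair] at h0 hs
  refine ⟨fun i => (hs i).1, h0.1, fun i => ?_⟩
  cases i with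
  | zero => exact h0.2
  | succ i => exact (hs i).2

theorem symbolicOutcome_apply (M : MDP Q A) (d₀ : PMF Q) (α : Strategy Q A) (k : ℕ) (q : Q) :
    M.symbolicOutcome d₀ α k q = M.pathMeasure d₀ α {π | (π k).1 = q} := by
  rw [symbolicOutcome, Measure.toPMF_apply,
    Measure.map_apply (by fun_prop) (measurableSet_singleton q)]
  rfl

theorem measurableSet_state {Q A : Type*} [MeasurableSpace Q] [DiscreteMeasurableSpace Q]
    [MeasurableSpace A] (k : ℕ) (S : Set Q) :
    MeasurableSet {π : ℕ → Q × A | (π k).1 ∈ S} :=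
  (measurable_fst.comp (measurable_pi_apply k)) (MeasurableSet.of_discrete (s := S))

theorem sum_symbolicOutcome (M : MDP Q A) (d₀ : PMF Q) (α : Strategy Q A) (k : ℕ) (T : Finset Q) :
    ∑ q ∈ T, M.symbolicOutcome d₀ α k q = M.pathMeasure d₀ α {π | (π k).1 ∈ T} := by
  rw [show {π : ℕ → Q × A | (π k).1 ∈ T} = ⋃ q ∈ T, {π | (π k).1 = q} by ext; simp,
    measure_biUnion_finset]
  · exact Finset.sum_congr rfl fun q _ => M.symbolicOutcome_apply d₀ α k q
  · intro q _ q' _ h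
    refine Set.disjoint_left.2 fun π h1 h2 => h (h1.symm.trans h2)
  · exact fun q _ => measurableSet_state k {q}

theorem pathMeasure_state_zero (M : MDP Q A) (d₀ : PMF Q) (α : Strategy Q A) (S : Set Q) :
    M.pathMeasure d₀ α {π | (π 0).1 ∈ S} = d₀.toMeasure S := by
  rw [← nextPair_toMeasure_preimage_fst α [], ← M.pathMeasure_map_zero,
    Measure.map_apply (measurable_pi_apply 0) .of_discrete]
  rfl

/-- The law of the state of index `k + 1`, in terms of the law of the pair of index `k`. -/
theorem pathMeasure_state_succ (M : MDP Q A) (d₀ : PMF Q) (α : Strategy Q A) (k : ℕ) (S : Set Q) :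
    M.pathMeasure d₀ α {π | (π (k + 1)).1 ∈ S} =
      ∫⁻ π, (M.δ (π k).1 (π k).2).toMeasure S ∂M.pathMeasure d₀ α := by
  have h : M.pathMeasure d₀ α {π | (π (k + 1)).1 ∈ S} =
      ((M.pathMeasure d₀ α).map fun π => (Preorder.frestrictLe k π, π (k + 1)))
        {x | x.2.1 ∈ S} := by
    rw [Measure.map_apply (by fun_prop) .of_discrete]
    rfl
  rw [h, M.pathMeasure_map_succ, Measure.compProd_apply .of_discrete,
    lintegral_map (Measurable.of_discrete) (by fun_prop)]
  refine lintegral_congr fun π => ?_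
  have e : M.stepKernel α k (Preorder.frestrictLe k π) =
      (nextPair α (prefixList π (k + 1)) (M.δ (π k).1 (π k).2)).toMeasure := rfl
  -- The state marginal of `nextPair` does not involve the strategy, so the history drops out.
  rw [e, ← nextPair_toMeasure_preimage_fst α (prefixList π (k + 1))]
  rfl

end PathMeasure

end SyncMDP.MDP

/-! ### The decreasing iteration of acceptable states. -/

namespace SyncMDP

/-- The support `P` of a distribution is acceptable for the target `W`: it is contained in `W`, and
it is a singleton when synchronization is measured by `max`. -/
def SyncKind.Accepts {Q : Type*} (W P : Set Q) : SyncKind → Prop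
  | SyncKind.sum => P ⊆ W
  | SyncKind.max => ∃ q ∈ W, P = {q}

theorem SyncKind.Accepts.subset {Q : Type*} {W P : Set Q} {k : SyncKind} (h : k.Accepts W P) :
    P ⊆ W := by
  cases k with
  | sum => exact h
  | max =>
    obtain ⟨q, hq, rfl⟩ := h
    exact Set.singleton_subset_iff.2 hq

namespace MDP

section Region
variable {Q : Type*} {A : Type*}

/-- The states that can stay in `T` for `i` steps, through acceptable transitions only. -/
def region (M : MDP Q A) (T : Set Q) (k : SyncKind) : ℕ → Set Q
  | 0 => T
  | i + 1 => {q | q ∈ M.region T k i ∧ ∃ a, k.Accepts (M.region T k i) (M.post q a)}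

variable (M : MDP Q A) (T : Set Q) (k : SyncKind)

theorem region_succ_subset (i : ℕ) : M.region T k (i + 1) ⊆ M.region T k i := fun _ h => h.1

theorem region_subset (i : ℕ) : M.region T k i ⊆ T := by
  induction i with
  | zero => exact subset_rfl
  | succ i ih => exact (M.region_succ_subset T k i).trans ih

/-- Each level is a function of the previous one, so equality of two consecutive levels persists;
until then every round loses at least one state. -/
theorem region_eq_or_ncard_add_le [Finite Q] (i : ℕ) :
    M.region T k (i + 1) = M.region T k i ∨ (M.region T k i).ncard + i ≤ Nat.card Q := by
  induction i with
  | zero => exact Or.inr (Set.ncard_le_card _)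
  | succ i ih =>
    rcases eq_or_ne (M.region T k (i + 1)) (M.region T k i) with h | h
    · exact Or.inl (by conv_lhs => rw [region, h]
                       conv_rhs => rw [region])
    · have h1 := ih.resolve_left h
      have h2 := Set.ncard_lt_ncard ((M.region_succ_subset T k i).ssubset_of_ne h)
      exact Or.inr (by omega)

theorem region_card_succ [Finite Q] :
    M.region T k (Nat.card Q + 1) = M.region T k (Nat.card Q) := by
  rcases M.region_eq_or_ncard_add_le T k (Nat.card Q) with h | h
  · exact h
  -- If every round up to this one lost a state, nothing is left.
  · have h0 : M.region T k (Nat.card Q) = ∅ := (Set.ncard_eq_zero).1 (by omega)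
    exact Set.Subset.antisymm (M.region_succ_subset T k _) (by rw [h0]; exact Set.empty_subset _)

/-- Stability gives an action that is acceptable for the same level, so the choice can be repeated
forever. -/
theorem exists_accepts [Finite Q] {q : Q} (hq : q ∈ M.region T k (Nat.card Q)) :
    ∃ a, k.Accepts (M.region T k (Nat.card Q)) (M.post q a) := by
  rw [← region_card_succ] at hq
  exact hq.2

end Region

section Paths
variable {Q : Type*} {A : Type*} (M : MDP Q A)

/-- Infinite paths of deterministic transitions inside the target set. -/
theorem exists_path_iff [Finite Q] (T : Set Q) (d₀ : PMF Q) :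
    (∃ π : ℕ → Q × A, π ∈ M.paths ∧ d₀ = PMF.pure (π 0).1 ∧
      (∀ i, (π i).1 ∈ T) ∧ ∀ i, M.δ (π i).1 (π i).2 (π (i + 1)).1 = 1) ↔
    SyncKind.max.Accepts (M.region T SyncKind.max (Nat.card Q)) d₀.support := by
  constructor
  · rintro ⟨π, -, rfl, hT, hδ⟩
    -- The induction on the level treats all times at once, since level `j + 1` at time `i` uses
    -- level `j` at time `i + 1`.
    have h : ∀ j i, (π i).1 ∈ M.region T SyncKind.max j := by
      intro j
      induction j with
      | zero => exact hT
      | succ j ih => exact fun i => ⟨ih i, (π i).2, _, ih (i + 1), (PMF.apply_eq_one_iff _ _).1 (hδ i)⟩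
    exact ⟨(π 0).1, h _ _, PMF.support_pure _⟩
  · rintro ⟨q₀, hq₀, hd⟩
    have h : ∀ q : M.region T SyncKind.max (Nat.card Q), ∃ a,
        ∃ q' : M.region T SyncKind.max (Nat.card Q), M.post q a = {q'.1} := fun q => by
      obtain ⟨a, q', hq', e⟩ := M.exists_accepts T SyncKind.max q.2
      exact ⟨a, ⟨q', hq'⟩, e⟩
    choose act next hnext using h
    have hs : ∀ i, M.post (next^[i] ⟨q₀, hq₀⟩).1 (act (next^[i] ⟨q₀, hq₀⟩)) =
        {(next^[i + 1] ⟨q₀, hq₀⟩).1} := fun i => by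
      rw [hnext, Function.iterate_succ_apply']
    refine ⟨fun i => ((next^[i] ⟨q₀, hq₀⟩).1, act (next^[i] ⟨q₀, hq₀⟩)), fun i => ?_, ?_,
      fun i => M.region_subset T _ _ (next^[i] ⟨q₀, hq₀⟩).2,
      fun i => (PMF.apply_eq_one_iff _ _).2 (hs i)⟩
    · simp only [hs, Set.mem_singleton_iff]
    · ext q
      by_cases hq : q = q₀
      · subst hq
        simpa using (PMF.apply_eq_one_iff _ _).2 hd
      · have : q ∉ d₀.support := by rw [hd]; exact hq
        simpa [PMF.pure_apply, hq] using (PMF.apply_eq_zero_iff _ _).2 this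

end Paths

/-! ### Winning strategies, necessity of the region condition, and equality of the modes. -/

section Strategy
variable {Q : Type*} {A : Type*} [Fintype Q] [MeasurableSpace Q] [DiscreteMeasurableSpace Q]
  [Fintype A] [MeasurableSpace A] [DiscreteMeasurableSpace A] (M : MDP Q A) (T : Finset Q)

/-- A pure memoryless strategy that keeps choosing acceptable actions. -/
theorem exists_pure_memoryless (k : SyncKind) {d₀ : PMF Q}
    (h : k.Accepts (M.region T k (Nat.card Q)) d₀.support) :
    ∃ α : Strategy Q A, α.IsPure ∧ α.IsMemoryless ∧
      AlwaysSynchronizing (k.fn T) 1 (M.symbolicOutcome d₀ α) ∧ M.outcomes d₀ α ⊆ safe T := by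
  classical
  -- `A` is not assumed nonempty: a state of the support provides the default action played outside
  -- the region.
  obtain ⟨q₁, hq₁⟩ := d₀.support_nonempty
  obtain ⟨a₁, -⟩ := M.exists_accepts T k (h.subset hq₁)
  have hact : ∀ q, ∃ a, q ∈ M.region T k (Nat.card Q) →
      k.Accepts (M.region T k (Nat.card Q)) (M.post q a) := fun q => by
    by_cases hq : q ∈ M.region T k (Nat.card Q)
    · exact (M.exists_accepts T k hq).imp fun _ ha _ => ha
    · exact ⟨a₁, fun hq' => absurd hq' hq⟩
  choose act hact using hact
  let α : Strategy Q A := fun _ q => PMF.pure (act q)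
  have hα : ∀ π ∈ M.outcomes d₀ α, ∀ i, (π i).2 = act (π i).1 := fun π hπ i => by
    simpa [α] using hπ.2.2 i
  have hR : ∀ π ∈ M.outcomes d₀ α, ∀ i, (π i).1 ∈ M.region T k (Nat.card Q) := by
    intro π hπ i
    induction i with
    | zero => exact h.subset hπ.2.1
    | succ i ih =>
      refine (hact _ ih).subset ?_
      rw [← hα π hπ]
      exact hπ.1 i
  have hT : M.outcomes d₀ α ⊆ safe T := fun π hπ i => M.region_subset _ k _ (hR π hπ i)
  refine ⟨α, fun _ q => ⟨act q, by simp [α]⟩, fun _ _ _ => rfl, fun i => ?_, hT⟩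
  cases k with
  | sum =>
    refine le_of_le_of_eq ?_ (M.sum_symbolicOutcome d₀ α i T).symm
    refine ((prob_compl_eq_zero_iff (measurableSet_state i (T : Set Q))).1 ?_).ge
    exact ae_iff.1 ((M.ae_mem_outcomes d₀ α).mono fun π hπ => hT hπ i)
  | max =>
    -- Accepted supports are singletons, so all outcomes visit the same state at each time.
    have hs : ∃ s ∈ M.region T SyncKind.max (Nat.card Q), ∀ π ∈ M.outcomes d₀ α, (π i).1 = s := by
      induction i with
      | zero =>
        obtain ⟨s, hs, e⟩ := h
        refine ⟨s, hs, fun π hπ => ?_⟩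
        have := hπ.2.1
        rwa [e] at this
      | succ i ih =>
        obtain ⟨s, hs, e⟩ := ih
        obtain ⟨s', hs', e'⟩ := hact s hs
        refine ⟨s', hs', fun π hπ => ?_⟩
        have := hπ.1 i
        rwa [hα π hπ, e π hπ, e'] at this
    obtain ⟨s, hs, e⟩ := hs
    refine le_trans ?_ (Finset.le_sup (f := fun q => M.symbolicOutcome d₀ α i q)
      (M.region_subset _ _ _ hs : s ∈ T))
    change 1 ≤ M.symbolicOutcome d₀ α i s
    rw [symbolicOutcome_apply]
    refine ((prob_compl_eq_zero_iff (measurableSet_state i {s})).1 ?_).ge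
    exact ae_iff.1 ((M.ae_mem_outcomes d₀ α).mono fun π hπ => e π hπ)

/-- A finite family has a least positive value. Zeros are replaced by `1` before the infimum, and
the minimum with `1` covers an empty family. -/
theorem exists_pos_le_of_ne_zero {ι X : Type*} [Finite ι] [Finite X] (f : ι → PMF X) :
    ∃ p : ℝ≥0∞, 0 < p ∧ p ≤ 1 ∧ ∀ i x, f i x ≠ 0 → p ≤ f i x := by
  classical
  have := Fintype.ofFinite ι
  have := Fintype.ofFinite X
  let g : ι × X → ℝ≥0∞ := fun y => if f y.1 y.2 = 0 then 1 else f y.1 y.2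
  refine ⟨min 1 (Finset.univ.inf g), lt_min one_pos ((Finset.lt_inf_iff ENNReal.zero_lt_top).2 ?_),
    min_le_left _ _, fun i x hx => ?_⟩
  · intro y _
    by_cases hy : f y.1 y.2 = 0
    · simp [g, hy]
    · simpa [g, hy] using pos_iff_ne_zero.2 hy
  · refine (min_le_right _ _).trans ((Finset.inf_le (Finset.mem_univ (i, x))).trans ?_)
    simp [g, hx]

theorem apply_le_toMeasure {X : Type*} [MeasurableSpace X] [DiscreteMeasurableSpace X] (d : PMF X)
    {S : Set X} {x : X} (hx : x ∈ S) : d x ≤ d.toMeasure S := by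
  rw [← PMF.toMeasure_apply_singleton d x .of_discrete]
  exact measure_mono (Set.singleton_subset_iff.2 hx)

theorem measure_compl_state_le {d₀ : PMF Q} {α : Strategy Q A} {ε : ℝ≥0∞} {i : ℕ} {S : Set Q}
    (h : 1 - ε ≤ M.pathMeasure d₀ α {π | (π i).1 ∈ S}) :
    M.pathMeasure d₀ α {π | (π i).1 ∈ Sᶜ} ≤ ε := by
  have e := prob_compl_eq_one_sub (μ := M.pathMeasure d₀ α) (measurableSet_state (A := A) i S)
  refine e.trans_le (tsub_le_iff_left.2 (tsub_le_iff_right.1 h))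

/-- The probability of being in a state from which all actions may lead to `S` is bounded in terms
of the probability of being in `S` one step later. -/
theorem mul_pathMeasure_state_le {p : ℝ≥0∞} (hp : ∀ q a q', M.δ q a q' ≠ 0 → p ≤ M.δ q a q')
    (d₀ : PMF Q) (α : Strategy Q A) (i : ℕ) {B S : Set Q}
    (hB : ∀ q ∈ B, ∀ a, ∃ q' ∈ M.post q a, q' ∈ S) :
    p * M.pathMeasure d₀ α {π | (π i).1 ∈ B} ≤ M.pathMeasure d₀ α {π | (π (i + 1)).1 ∈ S} := by
  have hm : Measurable fun π : ℕ → Q × A => (M.δ (π i).1 (π i).2).toMeasure S :=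
    (Measurable.of_discrete (f := fun x : Q × A => (M.δ x.1 x.2).toMeasure S)).comp
      (measurable_pi_apply i)
  rw [pathMeasure_state_succ]
  -- Markov's inequality at level `p`: on `B`, the integrand is at least the probability of one
  -- transition into `S`.
  refine le_trans ?_ (mul_meas_ge_le_lintegral hm p)
  gcongr
  intro hπ
  rename_i π
  obtain ⟨q', hq', hS⟩ := hB _ hπ (π i).2
  exact (hp _ _ _ hq').trans (apply_le_toMeasure _ hS)

/-- A quantitative version is what goes through the induction on levels: no strategy need be exactly
safe, but the error grows only by a factor that ignores the strategy. -/
theorem support_subset_region {d₀ : PMF Q}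
    (h : d₀ ∈ M.winAlways (SyncKind.sum.fn T) Mode.limitSure) (r : ℕ) :
    d₀.support ⊆ M.region T SyncKind.sum r := by
  obtain ⟨p, hp0, hp1, hp⟩ := exists_pos_le_of_ne_zero fun x : Q × A => M.δ x.1 x.2
  have key : ∃ c : ℝ≥0∞, c ≠ ⊤ ∧ ∀ (α : Strategy Q A) (ε : ℝ≥0∞),
      (∀ i, M.pathMeasure d₀ α {π | (π i).1 ∈ (T : Set Q)ᶜ} ≤ ε) →
      ∀ i, M.pathMeasure d₀ α {π | (π i).1 ∈ (M.region T SyncKind.sum r)ᶜ} ≤ c * ε := by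
    induction r with
    | zero => exact ⟨1, ENNReal.one_ne_top, fun α ε H i => by simpa [region] using H i⟩
    | succ r ih =>
      obtain ⟨c, hc, H⟩ := ih
      -- A state outside level `r + 1` is either outside level `r`, which costs `c`, or in `B`, from
      -- where mass at least `p` times its own is outside level `r` one step later.
      refine ⟨c + p⁻¹ * c, ENNReal.add_ne_top.2 ⟨hc, ENNReal.mul_ne_top
        (ENNReal.inv_ne_top.2 hp0.ne') hc⟩, fun α ε Hε i => ?_⟩
      let B : Set Q := {q | ∀ a, ∃ q' ∈ M.post q a, q' ∈ (M.region T SyncKind.sum r)ᶜ}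
      have hB := M.mul_pathMeasure_state_le (fun q a => hp (q, a)) d₀ α i (B := B) fun q hq => hq
      have hB' : M.pathMeasure d₀ α {π | (π i).1 ∈ B} ≤ p⁻¹ * (c * ε) := by
        rw [mul_comm, ← div_eq_mul_inv, ENNReal.le_div_iff_mul_le (Or.inl hp0.ne')
          (Or.inl (ne_top_of_le_ne_top ENNReal.one_ne_top hp1)), mul_comm]
        exact hB.trans (H α ε Hε (i + 1))
      rw [add_mul, mul_assoc]
      refine le_trans ?_ (add_le_add (H α ε Hε i) hB')
      refine le_trans (measure_mono fun π hπ => ?_) (measure_union_le _ _)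
      by_contra hcon
      refine hπ ?_
      simp only [Set.mem_union, Set.mem_ofPred_eq, Set.mem_compl_iff, not_or, not_not, B,
        not_forall, not_exists, not_and] at hcon
      exact ⟨hcon.1, hcon.2.imp fun a ha q' hq' => ha q' hq'⟩
  obtain ⟨c, hc, H⟩ := key
  intro q hq
  by_contra hqr
  have hle : ∀ ε : ℝ≥0∞, 0 < ε → d₀ q ≤ c * ε := fun ε hε => by
    obtain ⟨α, hα⟩ := h ε hε
    refine le_trans ?_ (H α ε (fun i => M.measure_compl_state_le ?_) 0)
    · rw [pathMeasure_state_zero]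
      exact apply_le_toMeasure d₀ hqr
    · exact (hα i).trans_eq (M.sum_symbolicOutcome d₀ α i T)
  refine hq (le_antisymm ?_ zero_le)
  refine ENNReal.le_of_forall_pos_le_add fun ε hε _ => ?_
  have hc1 : c + 1 ≠ ⊤ := ENNReal.add_ne_top.2 ⟨hc, ENNReal.one_ne_top⟩
  -- The divisor `c + 1` avoids the case `c = 0`.
  have := hle (ε / (c + 1)) (ENNReal.div_pos (by exact_mod_cast hε.ne') hc1)
  rw [zero_add]
  refine this.trans ?_
  calc c * (ε / (c + 1)) ≤ (c + 1) * (ε / (c + 1)) := by gcongr; exact le_self_add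
    _ = ε := ENNReal.mul_div_cancel (by simp) hc1

theorem exists_ne_of_apply_ne_one {X : Type*} (d : PMF X) {x : X} (h : d x ≠ 1) :
    ∃ y ∈ d.support, y ∈ ({x} : Set X)ᶜ := by
  by_contra! hcon
  refine h ((PMF.apply_eq_one_iff d x).2 (Set.Subset.antisymm (fun y hy => ?_) ?_))
  · simpa using hcon y hy
  · obtain ⟨y, hy⟩ := d.support_nonempty
    have e : y = x := by simpa using hcon y hy
    exact Set.singleton_subset_iff.2 (e ▸ hy)

/-- For `ε` small compared with `p`, each time has a state of `T` carrying mass at least `1 - ε`;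
these heavy states form the path. -/
theorem exists_path_of_limitSure {d₀ : PMF Q}
    (h : d₀ ∈ M.winAlways (SyncKind.max.fn T) Mode.limitSure) :
    ∃ π : ℕ → Q × A, π ∈ M.paths ∧ d₀ = PMF.pure (π 0).1 ∧
      (∀ i, (π i).1 ∈ (T : Set Q)) ∧ ∀ i, M.δ (π i).1 (π i).2 (π (i + 1)).1 = 1 := by
  -- The index `none` adds `d₀` to the family, so that one `p` also bounds the initial
  -- probabilities.
  obtain ⟨p, hp0, hp1, hp⟩ := exists_pos_le_of_ne_zero
    fun x : Option (Q × A) => x.elim d₀ fun x => M.δ x.1 x.2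
  set ε := p / 2 / 2 with hε
  have hεε : ε + ε = p / 2 := ENNReal.add_halves _
  have hlt : ε + ε < p := hεε ▸ ENNReal.half_lt_self hp0.ne' (ne_top_of_le_ne_top (by simp) hp1)
  have hε1 : ε ≤ 1 := le_self_add.trans (hlt.le.trans hp1)
  have hε0 : 0 < ε := ENNReal.half_pos (ENNReal.half_pos hp0.ne').ne'
  obtain ⟨α, hα⟩ := h ε hε0
  have hε1' : ε < 1 := lt_of_le_of_lt le_self_add (hlt.trans_le hp1)
  have hs : ∀ i, ∃ s ∈ T, 1 - ε ≤ M.pathMeasure d₀ α {π | (π i).1 ∈ ({s} : Set Q)} := fun i => by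
    have hi : 1 - ε ≤ T.sup fun q => M.symbolicOutcome d₀ α i q := hα i
    have hT : T.Nonempty := by
      rw [Finset.nonempty_iff_ne_empty]
      rintro rfl
      rw [Finset.sup_empty] at hi
      exact absurd hi (not_le.2 (tsub_pos_of_lt hε1'))
    obtain ⟨s, hs, e⟩ := Finset.exists_mem_eq_sup T hT fun q => M.symbolicOutcome d₀ α i q
    exact ⟨s, hs, (hi.trans_eq e).trans_eq (M.symbolicOutcome_apply d₀ α i s)⟩
  choose s hsT hs using hs
  have ha : ∀ i, ∃ a, M.δ (s i) a (s (i + 1)) = 1 := by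
    intro i
    -- Otherwise every action from `s i` leaks mass at least `p` away from `s (i + 1)`. Then `p * (1
    -- - ε) ≤ ε`, hence `p ≤ ε + ε`, against `hlt`.
    by_contra! hcon
    have h1 := M.mul_pathMeasure_state_le (fun q a => hp (some (q, a))) d₀ α i (B := {s i})
      (S := {s (i + 1)}ᶜ) (by
        rintro q rfl a
        exact exists_ne_of_apply_ne_one _ (hcon a))
    have h2 : p * (1 - ε) ≤ ε :=
      ((mul_le_mul_right (hs i) p).trans h1).trans (M.measure_compl_state_le (hs (i + 1)))
    refine absurd hlt (not_lt.2 ?_)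
    calc p = p * (1 - ε) + p * ε := by rw [← mul_add, tsub_add_cancel_of_le hε1, mul_one]
      _ ≤ ε + ε := add_le_add h2 (mul_le_of_le_one_left zero_le hp1)
  choose a ha using ha
  have hd : d₀ (s 0) = 1 := by
    by_contra hcon
    obtain ⟨q, hq, hq'⟩ := exists_ne_of_apply_ne_one _ hcon
    have h1 := M.measure_compl_state_le (hs 0)
    rw [pathMeasure_state_zero] at h1
    exact absurd ((hp none q hq).trans ((apply_le_toMeasure d₀ hq').trans h1))
      (not_le.2 (lt_of_le_of_lt le_self_add hlt))
  refine ⟨fun i => (s i, a i), fun i => ?_, ?_, hsT, ha⟩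
  · exact (PMF.mem_support_iff _ _).2 (by rw [ha i]; exact one_ne_zero)
  · have hd' := (PMF.apply_eq_one_iff _ _).1 hd
    ext q
    by_cases hq : q = s 0
    · subst hq
      simpa using hd
    · have : q ∉ d₀.support := by rw [hd']; exact hq
      simpa [PMF.pure_apply, hq] using (PMF.apply_eq_zero_iff _ _).2 this

theorem winAlways_sure_subset (f : PMF Q → ℝ≥0∞) (μ : Mode) :
    M.winAlways f Mode.sure ⊆ M.winAlways f μ := by
  rintro d₀ ⟨α, hα⟩
  cases μ with
  | sure => exact ⟨α, hα⟩
  | almostSure => exact ⟨α, fun ε _ i => tsub_le_self.trans (hα i)⟩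
  | limitSure => exact fun ε _ => ⟨α, fun i => tsub_le_self.trans (hα i)⟩

theorem winAlways_subset_limitSure (f : PMF Q → ℝ≥0∞) (μ : Mode) :
    M.winAlways f μ ⊆ M.winAlways f Mode.limitSure := by
  intro d₀ h
  cases μ with
  | sure => exact M.winAlways_sure_subset f _ h
  | almostSure =>
    obtain ⟨α, hα⟩ := h
    exact fun ε hε => ⟨α, hα ε hε⟩
  | limitSure => exact h

/-- Every mode implies limit-sure and is implied by sure, so the cycle closes through the region
condition. -/
theorem mem_winAlways_iff (k : SyncKind) (μ : Mode) (d₀ : PMF Q) :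
    d₀ ∈ M.winAlways (k.fn T) μ ↔ k.Accepts (M.region T k (Nat.card Q)) d₀.support := by
  constructor
  · intro h
    replace h := M.winAlways_subset_limitSure _ μ h
    cases k with
    | sum => exact M.support_subset_region T h _
    | max => exact (M.exists_path_iff T d₀).1 (M.exists_path_of_limitSure T h)
  · intro h
    obtain ⟨α, -, -, hα, -⟩ := M.exists_pure_memoryless T k h
    exact M.winAlways_sure_subset _ μ ⟨α, hα⟩

theorem mem_winEvent_safe_iff (ν : Mode) (d₀ : PMF Q) :
    d₀ ∈ M.winEvent (safe T) ν ↔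
      SyncKind.sum.Accepts (M.region T SyncKind.sum (Nat.card Q)) d₀.support := by
  have sure_almost : d₀ ∈ M.winEvent (safe T) Mode.sure →
      d₀ ∈ M.winEvent (safe T) Mode.almostSure := by
    rintro ⟨α, hα⟩
    exact ⟨α, (measure_congr (Filter.eventuallyEq_univ.2 ((M.ae_mem_outcomes d₀ α).mono hα))).trans
      measure_univ⟩
  have almost_limit : d₀ ∈ M.winEvent (safe T) Mode.almostSure →
      d₀ ∈ M.winEvent (safe T) Mode.limitSure := by
    rintro ⟨α, hα⟩
    exact le_antisymm (iSup_le fun _ => prob_le_one)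
      (hα ▸ le_iSup (fun α => M.pathMeasure d₀ α (safe T)) α)
  constructor
  · intro h
    have h' : d₀ ∈ M.winEvent (safe T) Mode.limitSure := by
      cases ν with
      | sure => exact almost_limit (sure_almost h)
      | almostSure => exact almost_limit h
      | limitSure => exact h
    -- The safety event lies in the event of being in `T` at time `i`, for every `i`, so limit-sure
    -- safety implies limit-sure synchronization.
    refine M.support_subset_region T (fun ε hε => ?_) _
    obtain ⟨α, hα⟩ := lt_iSup_iff.1
      (lt_of_lt_of_eq (ENNReal.sub_lt_self ENNReal.one_ne_top one_ne_zero hε.ne') (Eq.symm h'))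
    refine ⟨α, fun i => hα.le.trans ?_⟩
    refine (measure_mono ?_).trans_eq (M.sum_symbolicOutcome d₀ α i T).symm
    exact fun π hπ => hπ i
  · intro h
    obtain ⟨α, -, -, -, hα⟩ := M.exists_pure_memoryless T _ h
    cases ν with
    | sure => exact ⟨α, hα⟩
    | almostSure => exact sure_almost ⟨α, hα⟩
    | limitSure => exact almost_limit (sure_almost ⟨α, hα⟩)

end Strategy

end MDP
end SyncMDP

/-! ### A stack program for the iteration, and its running time. -/

namespace SyncMDP.Machine

open Computability (Γ')

/-- The state of a row scan: `none` when the row is rejected, otherwise whether a successor was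
seen. -/
abbrev RowState := Option Bool

/-- One step of a row scan, on reading the bit `b` of the row and the bit `w` of the target. -/
def rowStep (k : SyncKind) : RowState → Bool → Bool → RowState
  | none, _, _ => none
  | some s, false, _ => some s
  | some _, true, false => none
  | some s, true, true =>
    match k, s with
    | SyncKind.max, true => none
    | _, _ => some true

/-- The verdict of a row scan. -/
def rowVerdict : SyncKind → RowState → Bool
  | SyncKind.sum, r => r.isSome
  | SyncKind.max, r => r == some true

/-- The row scan of two bit lists. -/
def scanRow (k : SyncKind) : RowState → List Bool → List Bool → RowState
  | r, b :: bs, w :: ws => scanRow k (rowStep k r b w) bs ws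
  | r, _, _ => r

/-- The row `bs` is acceptable for the target `ws`. -/
def acceptRow (k : SyncKind) (bs ws : List Bool) : Bool :=
  rowVerdict k (scanRow k (some false) bs ws)

/-- One refinement of the target `ws`, for the transition table `gs`. -/
def refine (k : SyncKind) (gs : List (List (List Bool))) (ws : List Bool) : List Bool :=
  List.zipWith (fun u rows => u && rows.any fun bs => acceptRow k bs ws) ws gs

/-- The working stacks: the input, its part already read, the target, its part already read, the
target bits of the remaining states, the refined target, and the counter. -/
inductive Stack
  | input
  | read
  | target
  | targetRead
  | pending
  | refined
  | counter
  deriving DecidableEq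

instance : Fintype Stack where
  elems := {.input, .read, .target, .targetRead, .pending, .refined, .counter}
  complete i := by cases i <;> decide

/-- The labels of the machine. -/
inductive Label
  | count
  | skip
  | collect
  | load (acc : Bool)
  | tick (acc : Bool)
  | scan (fst acc found : Bool) (r : RowState)
  | look (fst acc found : Bool) (r : RowState) (b : Bool)
  | restore (acc found : Bool)
  | emit (acc found : Bool)
  | drop (acc : Bool)
  | rewind (acc : Bool)
  | clearInput (acc : Bool)
  | clearTarget (acc : Bool)
  | clearPending (acc : Bool)
  | finish (acc : Bool)
  deriving Fintype

/-- The contents of the working stacks. -/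
structure Store where
  input : List Γ'
  read : List Γ'
  target : List Γ'
  targetRead : List Γ'
  pending : List Γ'
  refined : List Γ'
  counter : List Γ'

/-- The contents of a stack. -/
def Store.get (s : Store) : Stack → List Γ'
  | .input => s.input
  | .read => s.read
  | .target => s.target
  | .targetRead => s.targetRead
  | .pending => s.pending
  | .refined => s.refined
  | .counter => s.counter

/-- Replace the contents of a stack. -/
def Store.set (s : Store) : Stack → List Γ' → Store
  | .input, l => { s with input := l }
  | .read, l => { s with read := l }
  | .target, l => { s with target := l }
  | .targetRead, l => { s with targetRead := l }
  | .pending, l => { s with pending := l }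
  | .refined, l => { s with refined := l }
  | .counter, l => { s with counter := l }

/-- Push symbols on stacks. -/
def Store.pushes (s : Store) : List (Stack × Γ') → Store
  | [] => s
  | (i, x) :: ps => (s.set i (x :: s.get i)).pushes ps

/-- The bit written as a symbol. -/
def bitOf : Γ' → Bool
  | Γ'.bit b => b
  | _ => false

/-- The program. A label either stops with an answer or pops a stack, and in function of the symbol
pushes symbols and jumps. -/
def op (k : SyncKind) : Label → Bool ⊕ (Stack × (Option Γ' → List (Stack × Γ') × Label))
  | .count => .inr (.input, fun
      -- The separator is counted too: there are `n + 1` passes, as a pass judges the initial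
      -- support against the target before refining it.
      | some Γ'.ket => ([(.counter, Γ'.ket)], .skip)
      | some x => ([(.counter, x)], .count)
      | none => ([], .skip))
  | .skip => .inr (.input, fun
      | some (Γ'.bit _) => ([], .skip)
      | _ => ([], .collect))
  | .collect => .inr (.input, fun
      | some (Γ'.bit b) => ([(.refined, Γ'.bit b)], .collect)
      | _ => ([], .load false))
  | .load acc => .inr (.refined, fun
      -- `refined` was filled in reverse; this transfer restores the order and makes two copies, one
      -- to scan and one to consume state by state.
      | some x => ([(.target, x), (.pending, x)], .load acc)
      | none => ([], .tick acc))
  | .tick acc => .inr (.counter, fun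
      | some _ => ([], .scan true acc false (some false))
      | none => ([], .clearInput acc))
  | .scan fst acc found r => .inr (.input, fun
      | some (Γ'.bit b) => ([(.read, Γ'.bit b)], .look fst acc found r b)
      -- With `fst` set, this separator ends the initial support; otherwise it ends the group of a
      -- state.
      | some Γ'.ket => ([(.read, Γ'.ket)],
          bif fst then .restore (rowVerdict k r) false else .emit acc found)
      | some x => ([(.read, x)], .restore acc (found || rowVerdict k r))
      | none => ([], .drop acc))
  | .look fst acc found r b => .inr (.target, fun
      | some x => ([(.targetRead, x)], .scan fst acc found (rowStep k r b (bitOf x)))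
      | none => ([], .scan fst acc found r))
  | .restore acc found => .inr (.targetRead, fun
      | some x => ([(.target, x)], .restore acc found)
      | none => ([], .scan false acc found (some false)))
  | .emit acc found => .inr (.pending, fun
      | some x => ([(.refined, Γ'.bit (bitOf x && found))], .scan false acc false (some false))
      | none => ([], .scan false acc false (some false)))
  | .drop acc => .inr (.target, fun
      | some _ => ([], .drop acc)
      | none => ([], .rewind acc))
  | .rewind acc => .inr (.read, fun
      | some x => ([(.input, x)], .rewind acc)
      | none => ([], .load acc))
  | .clearInput acc => .inr (.input, fun
      | some _ => ([], .clearInput acc)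
      | none => ([], .clearTarget acc))
  | .clearTarget acc => .inr (.target, fun
      | some _ => ([], .clearTarget acc)
      | none => ([], .clearPending acc))
  | .clearPending acc => .inr (.pending, fun
      | some _ => ([], .clearPending acc)
      | none => ([], .finish acc))
  | .finish acc => .inl acc

/-- One step of the program. -/
def next (k : SyncKind) (c : Label × Store) : Option (Label × Store) :=
  match op k c.1 with
  | .inl _ => none
  | .inr (i, f) =>
    some ((f (c.2.get i).head?).2, (c.2.set i (c.2.get i).tail).pushes (f (c.2.get i).head?).1)

/-- The program goes from one configuration to another in at most `t` steps. -/
inductive Runs (k : SyncKind) : ℕ → Label × Store → Label × Store → Prop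
  | refl (t : ℕ) (c : Label × Store) : Runs k t c c
  | step {t : ℕ} {c c' d : Label × Store} :
      next k c = some c' → Runs k t c' d → Runs k (t + 1) c d

theorem Runs.mono {k : SyncKind} {t t' : ℕ} {c d : Label × Store} (h : Runs k t c d)
    (ht : t ≤ t') : Runs k t' c d := by
  induction h generalizing t' with
  | refl => exact .refl _ _
  | step hn _ ih =>
    obtain ⟨t', rfl⟩ := Nat.exists_eq_add_of_le' (Nat.one_le_of_lt ht)
    exact .step hn (ih (by omega))

theorem Runs.trans {k : SyncKind} {t t' : ℕ} {c d e : Label × Store} (h : Runs k t c d)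
    (h' : Runs k t' d e) : Runs k (t + t') c e := by
  induction h with
  | refl => exact h'.mono (Nat.le_add_left _ _)
  | step hn _ ih => exact (Runs.step hn (ih h')).mono (by omega)

section Loops
variable (k : SyncKind)

/-- In the loop lemmas, `x y w v u n c` are the contents of `input`, `read`, `target`, `targetRead`,
`pending`, `refined`, `counter`. Single steps hold by computation. -/
theorem runs_count (a : List Bool) (x y w v u n c : List Γ') :
    Runs k (a.length + 1) (.count, ⟨a.map Γ'.bit ++ Γ'.ket :: x, y, w, v, u, n, c⟩)
      (.skip, ⟨x, y, w, v, u, n, Γ'.ket :: ((a.map Γ'.bit).reverse ++ c)⟩) := by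
  induction a generalizing c with
  | nil => exact .step rfl (.refl _ _)
  | cons b a ih =>
    simpa using Runs.step (c := (.count, ⟨(b :: a).map Γ'.bit ++ Γ'.ket :: x, y, w, v, u, n, c⟩))
      rfl (ih (Γ'.bit b :: c))

theorem runs_skip (a : List Bool) (x y w v u n c : List Γ') :
    Runs k (a.length + 1) (.skip, ⟨a.map Γ'.bit ++ Γ'.ket :: x, y, w, v, u, n, c⟩)
      (.collect, ⟨x, y, w, v, u, n, c⟩) := by
  induction a with
  | nil => exact .step rfl (.refl _ _)
  | cons b a ih => exact .step rfl ih

theorem runs_collect (a : List Bool) (x y w v u n c : List Γ') :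
    Runs k (a.length + 1) (.collect, ⟨a.map Γ'.bit ++ Γ'.ket :: x, y, w, v, u, n, c⟩)
      (.load false, ⟨x, y, w, v, u, (a.map Γ'.bit).reverse ++ n, c⟩) := by
  induction a generalizing n with
  | nil => exact .step rfl (.refl _ _)
  | cons b a ih =>
    simpa using Runs.step (c := (.collect, ⟨(b :: a).map Γ'.bit ++ Γ'.ket :: x, y, w, v, u, n, c⟩))
      rfl (ih (Γ'.bit b :: n))

theorem runs_load (acc : Bool) (x y w v u n c : List Γ') :
    Runs k (n.length + 1) (.load acc, ⟨x, y, w, v, u, n, c⟩)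
      (.tick acc, ⟨x, y, n.reverse ++ w, v, n.reverse ++ u, [], c⟩) := by
  induction n generalizing w u with
  | nil => exact .step rfl (.refl _ _)
  | cons b n ih =>
    simpa using Runs.step (c := (.load acc, ⟨x, y, w, v, u, b :: n, c⟩)) rfl (ih (b :: w) (b :: u))

theorem runs_restore (acc found : Bool) (x y w v u n c : List Γ') :
    Runs k (v.length + 1) (.restore acc found, ⟨x, y, w, v, u, n, c⟩)
      (.scan false acc found (some false), ⟨x, y, v.reverse ++ w, [], u, n, c⟩) := by
  induction v generalizing w with
  | nil => exact .step rfl (.refl _ _)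
  | cons b v ih =>
    simpa using Runs.step (c := (.restore acc found, ⟨x, y, w, b :: v, u, n, c⟩)) rfl (ih (b :: w))

theorem runs_drop (acc : Bool) (x y w v u n c : List Γ') :
    Runs k (w.length + 1) (.drop acc, ⟨x, y, w, v, u, n, c⟩)
      (.rewind acc, ⟨x, y, [], v, u, n, c⟩) := by
  induction w with
  | nil => exact .step rfl (.refl _ _)
  | cons b w ih => exact .step rfl ih

theorem runs_rewind (acc : Bool) (x y w v u n c : List Γ') :
    Runs k (y.length + 1) (.rewind acc, ⟨x, y, w, v, u, n, c⟩)
      (.load acc, ⟨y.reverse ++ x, [], w, v, u, n, c⟩) := by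
  induction y generalizing x with
  | nil => exact .step rfl (.refl _ _)
  | cons b y ih =>
    simpa using Runs.step (c := (.rewind acc, ⟨x, b :: y, w, v, u, n, c⟩)) rfl (ih (b :: x))

theorem runs_clearInput (acc : Bool) (x y w v u n c : List Γ') :
    Runs k (x.length + 1) (.clearInput acc, ⟨x, y, w, v, u, n, c⟩)
      (.clearTarget acc, ⟨[], y, w, v, u, n, c⟩) := by
  induction x with
  | nil => exact .step rfl (.refl _ _)
  | cons b x ih => exact .step rfl ih

theorem runs_clearTarget (acc : Bool) (x y w v u n c : List Γ') :
    Runs k (w.length + 1) (.clearTarget acc, ⟨x, y, w, v, u, n, c⟩)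
      (.clearPending acc, ⟨x, y, [], v, u, n, c⟩) := by
  induction w with
  | nil => exact .step rfl (.refl _ _)
  | cons b w ih => exact .step rfl ih

theorem runs_clearPending (acc : Bool) (x y w v u n c : List Γ') :
    Runs k (u.length + 1) (.clearPending acc, ⟨x, y, w, v, u, n, c⟩)
      (.finish acc, ⟨x, y, w, v, [], n, c⟩) := by
  induction u with
  | nil => exact .step rfl (.refl _ _)
  | cons b u ih => exact .step rfl ih

theorem runs_scanRow (fst acc found : Bool) (r : RowState) (bs ws : List Bool)
    (h : bs.length = ws.length) (x y w v u n c : List Γ') :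
    Runs k (2 * bs.length)
      (.scan fst acc found r, ⟨bs.map Γ'.bit ++ x, y, ws.map Γ'.bit ++ w, v, u, n, c⟩)
      (.scan fst acc found (scanRow k r bs ws),
        ⟨x, (bs.map Γ'.bit).reverse ++ y, w, (ws.map Γ'.bit).reverse ++ v, u, n, c⟩) := by
  induction bs generalizing r ws y v with
  | nil =>
    obtain rfl : ws = [] := List.length_eq_zero_iff.1 h.symm
    exact .refl _ _
  | cons b bs ih =>
    obtain _ | ⟨w', ws⟩ := ws
    · simp at h
    have h1 := ih (rowStep k r b w') ws (by simpa using h) (Γ'.bit b :: y) (Γ'.bit w' :: v)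
    have h2 := Runs.step (c := (.look fst acc found r b, ⟨bs.map Γ'.bit ++ x, Γ'.bit b :: y,
      (w' :: ws).map Γ'.bit ++ w, v, u, n, c⟩)) rfl h1
    have h3 := Runs.step (c := (.scan fst acc found r, ⟨(b :: bs).map Γ'.bit ++ x, y,
      (w' :: ws).map Γ'.bit ++ w, v, u, n, c⟩)) rfl h2
    simpa [scanRow, Nat.mul_succ] using h3

/-- A row as it is written on the input stack. -/
def encodeRow (bs : List Bool) : List Γ' := bs.map Γ'.bit ++ [Γ'.comma]

/-- The rows of a state as they are written on the input stack. -/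
def encodeGroup (rows : List (List Bool)) : List Γ' := (rows.map encodeRow).flatten ++ [Γ'.ket]

/-- A transition table as it is written on the input stack. -/
def encodeTable (gs : List (List (List Bool))) : List Γ' := (gs.map encodeGroup).flatten

theorem runs_init (acc : Bool) (bs ws : List Bool) (h : bs.length = ws.length)
    (x y u n c : List Γ') :
    Runs k (3 * (bs.map Γ'.bit ++ [Γ'.ket]).length)
      (.scan true acc false (some false),
        ⟨bs.map Γ'.bit ++ Γ'.ket :: x, y, ws.map Γ'.bit, [], u, n, c⟩)
      (.scan false (acceptRow k bs ws) false (some false),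
        ⟨x, (bs.map Γ'.bit ++ [Γ'.ket]).reverse ++ y, ws.map Γ'.bit, [], u, n, c⟩) := by
  have h1 := runs_scanRow k true acc false (some false) bs ws h (Γ'.ket :: x) y [] [] u n c
  have h2 := runs_restore k (acceptRow k bs ws) false x (Γ'.ket :: ((bs.map Γ'.bit).reverse ++ y))
    [] ((ws.map Γ'.bit).reverse ++ []) u n c
  have h3 := h1.trans (.step rfl h2)
  simp only [List.append_nil, List.reverse_reverse] at h3
  rw [List.reverse_append]
  refine h3.mono ?_
  simp
  omega

/-- Each bit costs two steps to scan and one to restore the target; the two remaining steps fit in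
the share of the comma. -/
theorem runs_row (acc found : Bool) (bs ws : List Bool) (h : bs.length = ws.length)
    (x y u n c : List Γ') :
    Runs k (3 * (encodeRow bs).length)
      (.scan false acc found (some false), ⟨encodeRow bs ++ x, y, ws.map Γ'.bit, [], u, n, c⟩)
      (.scan false acc (found || acceptRow k bs ws) (some false),
        ⟨x, (encodeRow bs).reverse ++ y, ws.map Γ'.bit, [], u, n, c⟩) := by
  have h1 := runs_scanRow k false acc found (some false) bs ws h (Γ'.comma :: x) y [] [] u n c
  have h2 := runs_restore k acc (found || acceptRow k bs ws) x
    (Γ'.comma :: ((bs.map Γ'.bit).reverse ++ y)) [] ((ws.map Γ'.bit).reverse ++ []) u n c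
  have h3 := h1.trans (.step rfl h2)
  simp only [List.append_nil, List.reverse_reverse] at h3
  rw [encodeRow, List.reverse_append, List.append_assoc]
  refine h3.mono ?_
  simp
  omega

theorem runs_rows (acc found : Bool) (rows : List (List Bool)) (ws : List Bool)
    (h : ∀ bs ∈ rows, bs.length = ws.length) (x y u n c : List Γ') :
    Runs k (3 * (rows.map encodeRow).flatten.length)
      (.scan false acc found (some false),
        ⟨(rows.map encodeRow).flatten ++ x, y, ws.map Γ'.bit, [], u, n, c⟩)
      (.scan false acc (found || rows.any fun bs => acceptRow k bs ws) (some false),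
        ⟨x, (rows.map encodeRow).flatten.reverse ++ y, ws.map Γ'.bit, [], u, n, c⟩) := by
  induction rows generalizing found y with
  | nil => simpa using Runs.refl _ _
  | cons bs rows ih =>
    have h1 := runs_row k acc found bs ws (h bs (by simp)) ((rows.map encodeRow).flatten ++ x) y u n c
    have h2 := h1.trans (ih (found || acceptRow k bs ws) (fun bs' hb => h bs' (by simp [hb]))
      ((encodeRow bs).reverse ++ y))
    rw [← Nat.mul_add] at h2
    simpa [Bool.or_assoc] using h2

theorem runs_group (acc b : Bool) (rows : List (List Bool)) (ws : List Bool)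
    (h : ∀ bs ∈ rows, bs.length = ws.length) (x y u n c : List Γ') :
    Runs k (3 * (encodeGroup rows).length)
      (.scan false acc false (some false),
        ⟨encodeGroup rows ++ x, y, ws.map Γ'.bit, [], Γ'.bit b :: u, n, c⟩)
      (.scan false acc false (some false),
        ⟨x, (encodeGroup rows).reverse ++ y, ws.map Γ'.bit, [], u,
          Γ'.bit (b && rows.any fun bs => acceptRow k bs ws) :: n, c⟩) := by
  have h1 := runs_rows k acc false rows ws h (Γ'.ket :: x) y (Γ'.bit b :: u) n c
  -- Reading the `ket` and emitting the bit take two steps; the slack of `1` keeps the bound at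
  -- exactly three per symbol.
  have h2 := h1.trans (.step rfl (.step rfl (.refl 1 _)))
  rw [encodeGroup, List.append_assoc]
  simp only [List.length_append, List.length_singleton, Nat.mul_add]
  rw [List.reverse_append]
  exact h2

/-- The pending bits `us` are kept apart from the target `ws` because the induction consumes the
former and must leave the latter intact. -/
theorem runs_groups (acc : Bool) (gs : List (List (List Bool))) (us ws : List Bool)
    (hl : us.length = gs.length)
    (h : ∀ rows ∈ gs, ∀ bs ∈ rows, bs.length = ws.length) (x y n c : List Γ') :
    Runs k (3 * (encodeTable gs).length)
      (.scan false acc false (some false),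
        ⟨encodeTable gs ++ x, y, ws.map Γ'.bit, [], us.map Γ'.bit, n, c⟩)
      (.scan false acc false (some false),
        ⟨x, (encodeTable gs).reverse ++ y, ws.map Γ'.bit, [], [],
          ((List.zipWith (fun u rows => u && rows.any fun bs => acceptRow k bs ws) us gs).map
            Γ'.bit).reverse ++ n, c⟩) := by
  induction gs generalizing us y n with
  | nil =>
    obtain rfl : us = [] := List.length_eq_zero_iff.1 hl
    exact .refl _ _
  | cons rows gs ih =>
    obtain _ | ⟨b, us⟩ := us
    · simp at hl
    have h1 := runs_group k acc b rows ws (h rows (by simp)) (encodeTable gs ++ x) y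
      (us.map Γ'.bit) n c
    have h2 := h1.trans (ih us (by simpa using hl) (fun r hr => h r (by simp [hr]))
      ((encodeGroup rows).reverse ++ y) _)
    rw [← Nat.mul_add] at h2
    simpa [encodeTable] using h2

end Loops

/-- The transition table `gs` and the row `init` have the dimensions of a system with `n` states. -/
structure WellFormed (n : ℕ) (gs : List (List (List Bool))) (init : List Bool) : Prop where
  length_init : init.length = n
  length_table : gs.length = n
  length_row : ∀ rows ∈ gs, ∀ bs ∈ rows, bs.length = n

theorem length_refine (k : SyncKind) {n : ℕ} {gs : List (List (List Bool))} {init ws : List Bool}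
    (hwf : WellFormed n gs init) (hw : ws.length = n) : (refine k gs ws).length = n := by
  simp [refine, hw, hwf.length_table]

/-- The part of the input that is read at each pass. -/
def encodeBody (gs : List (List (List Bool))) (init : List Bool) : List Γ' :=
  init.map Γ'.bit ++ Γ'.ket :: encodeTable gs

theorem runs_pass (k : SyncKind) {m : ℕ} {gs : List (List (List Bool))} {init ws : List Bool}
    (hwf : WellFormed m gs init) (hw : ws.length = m) (acc : Bool) (z : Γ') (c : List Γ') :
    Runs k (12 * (encodeBody gs init).length)
      (.tick acc, ⟨encodeBody gs init, [], ws.map Γ'.bit, [], ws.map Γ'.bit, [], z :: c⟩)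
      (.tick (acceptRow k init ws), ⟨encodeBody gs init, [], (refine k gs ws).map Γ'.bit, [],
        (refine k gs ws).map Γ'.bit, [], c⟩) := by
  have h1 := runs_init k acc init ws (hwf.length_init.trans hw.symm) (encodeTable gs ++ []) []
    (ws.map Γ'.bit) [] c
  have h2 := runs_groups k (acceptRow k init ws) gs ws ws (hw.trans hwf.length_table.symm)
    (by rw [hw]; exact hwf.length_row) [] ((init.map Γ'.bit ++ [Γ'.ket]).reverse ++ []) [] c
  have h3 := runs_drop k (acceptRow k init ws) []
    ((encodeTable gs).reverse ++ ((init.map Γ'.bit ++ [Γ'.ket]).reverse ++ [])) (ws.map Γ'.bit)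
    [] [] (((refine k gs ws).map Γ'.bit).reverse ++ []) c
  have h4 := runs_rewind k (acceptRow k init ws) []
    ((encodeTable gs).reverse ++ ((init.map Γ'.bit ++ [Γ'.ket]).reverse ++ [])) [] [] []
    (((refine k gs ws).map Γ'.bit).reverse ++ []) c
  have e : ((encodeTable gs).reverse ++ ((init.map Γ'.bit ++ [Γ'.ket]).reverse ++ [])).reverse ++ []
      = encodeBody gs init := by simp [encodeBody]
  rw [e] at h4
  have h5 := runs_load k (acceptRow k init ws) (encodeBody gs init) [] [] [] []
    (((refine k gs ws).map Γ'.bit).reverse ++ []) c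
  have h6 := h1.trans (h2.trans (.step rfl (h3.trans (h4.trans h5))))
  simp only [List.append_nil, List.reverse_reverse] at h6
  replace h6 := Runs.step (c := (.tick acc, ⟨encodeBody gs init, [], ws.map Γ'.bit, [],
    ws.map Γ'.bit, [], z :: c⟩)) rfl h6
  refine h6.mono ?_
  have := hwf.length_init
  have := length_refine k hwf hw
  simp [encodeBody]
  omega

/-- The verdict lags one refinement behind the target, hence the exponents `c.length` and `c.length
+ 1`. -/
theorem runs_passes (k : SyncKind) {m : ℕ} {gs : List (List (List Bool))} {init : List Bool}
    (hwf : WellFormed m gs init) (z : Γ') (c : List Γ') (ws : List Bool) (hw : ws.length = m)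
    (acc : Bool) :
    Runs k ((c.length + 1) * (12 * (encodeBody gs init).length))
      (.tick acc, ⟨encodeBody gs init, [], ws.map Γ'.bit, [], ws.map Γ'.bit, [], z :: c⟩)
      (.tick (acceptRow k init ((refine k gs)^[c.length] ws)),
        ⟨encodeBody gs init, [], ((refine k gs)^[c.length + 1] ws).map Γ'.bit, [],
          ((refine k gs)^[c.length + 1] ws).map Γ'.bit, [], []⟩) := by
  induction c generalizing z ws acc with
  | nil => simpa using runs_pass k hwf hw acc z []
  | cons z' c ih =>
    have h1 := (runs_pass k hwf hw acc z (z' :: c)).trans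
      (ih z' (refine k gs ws) (length_refine k hwf hw) (acceptRow k init ws))
    refine (Runs.mono h1 (le_of_eq ?_))
    rw [List.length_cons]
    ring

theorem length_iterate_refine (k : SyncKind) {n : ℕ} {gs : List (List (List Bool))}
    {init ws : List Bool} (hwf : WellFormed n gs init) (hw : ws.length = n) (i : ℕ) :
    ((refine k gs)^[i] ws).length = n := by
  induction i with
  | zero => exact hw
  | succ i ih =>
    rw [Function.iterate_succ_apply']
    exact length_refine k hwf ih

/-- The whole run, on a well-formed input. -/
theorem runs_main (k : SyncKind) {gs : List (List (List Bool))} {init ws a b : List Bool}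
    (hwf : WellFormed a.length gs init) (hw : ws.length = a.length) {l : List Γ'}
    (hl : l = a.map Γ'.bit ++ Γ'.ket :: (b.map Γ'.bit ++ Γ'.ket :: (ws.map Γ'.bit ++
      Γ'.ket :: encodeBody gs init))) :
    Runs k (12 * l.length ^ 2 + 4 * l.length + 3) (.count, ⟨l, [], [], [], [], [], []⟩)
      (.finish (acceptRow k init ((refine k gs)^[a.length] ws)),
        ⟨[], [], [], [], [], [], []⟩) := by
  subst hl
  set l := a.map Γ'.bit ++ Γ'.ket :: (b.map Γ'.bit ++ Γ'.ket :: (ws.map Γ'.bit ++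
      Γ'.ket :: encodeBody gs init)) with hl
  have h1 := runs_count k a (b.map Γ'.bit ++ Γ'.ket :: (ws.map Γ'.bit ++
      Γ'.ket :: encodeBody gs init)) [] [] [] [] [] []
  have h2 := runs_skip k b (ws.map Γ'.bit ++ Γ'.ket :: encodeBody gs init) [] [] [] [] []
    (Γ'.ket :: ((a.map Γ'.bit).reverse ++ []))
  have h3 := runs_collect k ws (encodeBody gs init) [] [] [] [] []
    (Γ'.ket :: ((a.map Γ'.bit).reverse ++ []))
  have h4 := runs_load k false (encodeBody gs init) [] [] [] [] ((ws.map Γ'.bit).reverse ++ [])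
    (Γ'.ket :: ((a.map Γ'.bit).reverse ++ []))
  have h5 := runs_passes k hwf Γ'.ket (a.map Γ'.bit).reverse ws hw false
  set acc := acceptRow k init ((refine k gs)^[a.length] ws) with hacc
  set ws' := (refine k gs)^[a.length + 1] ws with hws'
  have h6 := runs_clearInput k acc (encodeBody gs init) [] (ws'.map Γ'.bit) [] (ws'.map Γ'.bit) [] []
  have h7 := runs_clearTarget k acc [] [] (ws'.map Γ'.bit) [] (ws'.map Γ'.bit) [] []
  have h8 := runs_clearPending k acc [] [] [] [] (ws'.map Γ'.bit) [] []
  simp only [List.append_nil, List.reverse_reverse, List.length_reverse, List.length_map]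
    at h1 h2 h3 h4 h5 h6 h7 h8
  have h9 := h1.trans (h2.trans (h3.trans (h4.trans (h5.trans (.step rfl (h6.trans
    (h7.trans h8)))))))
  refine h9.mono ?_
  have hw' : ws'.length = a.length := length_iterate_refine k hwf hw _
  have hll : l.length = a.length + b.length + ws.length + 3 + (encodeBody gs init).length := by
    simp [hl]
    omega
  -- The passes give the quadratic term: both their number and the length of the part they read are
  -- at most `l.length`. Everything else is linear.
  have hm : (a.length + 1) * (12 * (encodeBody gs init).length) ≤ 12 * l.length ^ 2 := by
    have : (a.length + 1) * (encodeBody gs init).length ≤ l.length * l.length :=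
      Nat.mul_le_mul (by omega) (by omega)
    nlinarith
  omega

end SyncMDP.Machine

/-! ### Realization of the program as a Turing machine with stacks. -/

namespace SyncMDP.Machine

open Computability (Γ')
open Turing

/-- The alphabets of the stacks: the output stack holds an answer. -/
abbrev Alphabet : Option Stack → Type
  | none => Bool
  | some _ => Γ'

/-- Statements of the stack machine, which stores the last symbol that was popped. -/
abbrev Stmt := TM2.Stmt Alphabet Label (Option Γ')

/-- The case distinction on the last symbol that was popped. -/
def switch (g : Option Γ' → Stmt) : Stmt :=
  -- The number of pushes depends on the symbol popped, so all seven possible values are separated.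
  .branch (fun v => v == none) (g none) <|
  .branch (fun v => v == some Γ'.blank) (g (some Γ'.blank)) <|
  .branch (fun v => v == some (Γ'.bit false)) (g (some (Γ'.bit false))) <|
  .branch (fun v => v == some (Γ'.bit true)) (g (some (Γ'.bit true))) <|
  .branch (fun v => v == some Γ'.bra) (g (some Γ'.bra)) <|
  .branch (fun v => v == some Γ'.ket) (g (some Γ'.ket)) (g (some Γ'.comma))

theorem stepAux_switch (g : Option Γ' → Stmt) (v : Option Γ') (S : ∀ i, List (Alphabet i)) :
    TM2.stepAux (switch g) v S = TM2.stepAux (g v) v S := by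
  rcases v with _ | _ | ⟨_ | _⟩ | _ | _ | _ <;> rfl

/-- Push symbols on the working stacks, then forget the last symbol popped and jump. -/
def pushThen : List (Stack × Γ') → Label → Stmt
  | [], l => .load (fun _ => none) (.goto fun _ => l)
  | (i, x) :: ps, l => .push (some i) (fun _ => x) (pushThen ps l)

/-- The statement at a label. -/
def stmt (k : SyncKind) (l : Label) : Stmt :=
  match op k l with
  | .inl b => .push none (fun _ => b) .halt
  | .inr (i, f) => .pop (some i) (fun _ x => x) (switch fun x => pushThen (f x).1 (f x).2)

/-- The machine that solves the membership problem. -/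
def machine (k : SyncKind) : FinTM2 where
  K := Option Stack
  k₀ := some .input
  k₁ := none
  Γ := Alphabet
  Λ := Label
  main := .count
  σ := Option Γ'
  initialState := none
  Γk₀Fin := inferInstanceAs (Fintype Γ')
  m := stmt k

/-- The stacks of the machine, the output stack being empty. -/
def Store.stacks (s : Store) : ∀ i, List (Alphabet i)
  | none => []
  | some i => s.get i

theorem Store.stacks_set (s : Store) (i : Stack) (l : List Γ') :
    (s.set i l).stacks = Function.update s.stacks (some i) l := by
  funext j
  obtain _ | j := j
  · rfl
  · cases i <;> cases j <;> rfl

/-- The configuration of the machine. -/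
def toCfg (c : Label × Store) : TM2.Cfg Alphabet Label (Option Γ') :=
  ⟨some c.1, none, c.2.stacks⟩

theorem stepAux_pushThen (ps : List (Stack × Γ')) (l : Label) (v : Option Γ') (s : Store) :
    TM2.stepAux (pushThen ps l) v s.stacks = toCfg (l, s.pushes ps) := by
  induction ps generalizing s with
  | nil => rfl
  | cons p ps ih =>
    obtain ⟨i, x⟩ := p
    rw [pushThen, TM2.stepAux, Store.pushes, ← ih, Store.stacks_set]
    rfl

/-- The pop, the branching, the pushes and the jump form a single statement, hence one machine step;
`pushThen` resets the memory to `none`, as `toCfg` requires. -/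
theorem step_toCfg {k : SyncKind} {c c' : Label × Store} (h : next k c = some c') :
    TM2.step (stmt k) (toCfg c) = some (toCfg c') := by
  obtain ⟨l, s⟩ := c
  rw [toCfg, TM2.step, stmt]
  rw [next] at h
  cases ho : op k l with
  | inl b => simp [ho] at h
  | inr p =>
    obtain ⟨i, f⟩ := p
    simp only [ho, Option.some.injEq] at h
    subst h
    simp only
    rw [TM2.stepAux, stepAux_switch, ← stepAux_pushThen, Store.stacks_set]
    rfl

theorem Runs.exists_iterate {k : SyncKind} {t : ℕ} {c d : Label × Store} (h : Runs k t c d) :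
    ∃ n ≤ t, (flip bind (TM2.step (stmt k)))^[n] (some (toCfg c)) = some (toCfg d) := by
  induction h with
  | refl t c => exact ⟨0, Nat.zero_le _, rfl⟩
  | step hn _ ih =>
    obtain ⟨n, hn', e⟩ := ih
    refine ⟨n + 1, Nat.succ_le_succ hn', ?_⟩
    rw [Function.iterate_succ_apply, ← e]
    congr 1
    exact step_toCfg hn

theorem initList_eq (k : SyncKind) (l : List Γ') :
    initList (machine k) l = toCfg (.count, ⟨l, [], [], [], [], [], []⟩) := by
  refine congrArg (TM2.Cfg.mk _ _) (funext fun i => ?_)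
  rcases i with _ | i
  · rfl
  · cases i <;> rfl

theorem step_finish (k : SyncKind) (b : Bool) :
    TM2.step (stmt k) (toCfg (.finish b, ⟨[], [], [], [], [], [], []⟩)) =
      some (haltList (machine k) [b]) := by
  refine congrArg some (congrArg (TM2.Cfg.mk _ _) (funext fun i => ?_))
  rcases i with _ | i
  · rfl
  · cases i <;> rfl

/-- The rows of the transition table of an input, as lists of bits. -/
def tableLists {n m : ℕ} (R : Fin n → Fin m → Fin n → Bool) : List (List (List Bool)) :=
  List.ofFn fun q => List.ofFn fun a => List.ofFn (R q a)

/-- The answer of the machine. -/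
def answer (k : SyncKind) (I : Input) : Bool :=
  acceptRow k (List.ofFn I.init) ((refine k (tableLists I.trans))^[I.n] (List.ofFn I.target))

theorem bits_eq {n : ℕ} (f : Fin n → Bool) : bits f = (List.ofFn f).map Γ'.bit := by
  rw [bits, List.map_ofFn]
  rfl

theorem table_eq {n m : ℕ} (R : Fin n → Fin m → Fin n → Bool) :
    table R = encodeTable (tableLists R) := by
  simp only [table, encodeTable, tableLists, List.map_ofFn, bits_eq]
  congr 2
  funext q
  simp only [encodeGroup, encodeRow, List.map_ofFn, Function.comp_def]

theorem encode_eq (I : Input) : I.encode =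
    (List.replicate I.n true).map Γ'.bit ++ Γ'.ket :: ((List.replicate I.m true).map Γ'.bit ++
      Γ'.ket :: ((List.ofFn I.target).map Γ'.bit ++ Γ'.ket ::
        encodeBody (tableLists I.trans) (List.ofFn I.init))) := by
  simp only [Input.encode, encodeBody, bits_eq, table_eq, List.map_replicate]

theorem polyTime_answer (k : SyncKind) : PolyTime (answer k) := by
  refine ⟨⟨⟨machine k, Equiv.refl _, Equiv.refl _⟩,
    12 * Polynomial.X ^ 2 + 4 * Polynomial.X + 4, fun I => ?_⟩⟩
  have hwf : WellFormed (List.replicate I.n true).length (tableLists I.trans) (List.ofFn I.init) :=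
    ⟨by simp, by simp [tableLists], by simp [tableLists, List.mem_ofFn]⟩
  have h := (runs_main k hwf (by simp) (encode_eq I)).exists_iterate
  rw [List.length_replicate, ← answer] at h
  have h' : ∃ n ≤ 12 * I.encode.length ^ 2 + 4 * I.encode.length + 4,
      (flip bind (TM2.step (stmt k)))^[n] (some (initList (machine k) I.encode)) =
        some (haltList (machine k) [answer k I]) := by
    obtain ⟨n, hn, e⟩ := h
    -- The extra step writes the answer and halts, which turns the constant `3` of `runs_main` into
    -- `4`.
    refine ⟨n + 1, Nat.succ_le_succ hn, ?_⟩
    rw [Function.iterate_succ_apply', initList_eq, e]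
    exact step_finish k _
  refine ⟨⟨h'.choose, ?_⟩, ?_⟩
  · exact (congrArg (fun l => (flip bind (TM2.step (stmt k)))^[h'.choose]
      (some (initList (machine k) l))) (List.map_id I.encode)).trans h'.choose_spec.2
  · simpa using h'.choose_spec.1

end SyncMDP.Machine

/-! ### The program computes the region. -/

namespace SyncMDP.Machine

open Computability (Γ')

theorem scanRow_none (k : SyncKind) (bs ws : List Bool) : scanRow k none bs ws = none := by
  induction bs generalizing ws with
  | nil => simp [scanRow]
  | cons b bs ih => cases ws <;> simp [scanRow, rowStep, ih]

theorem scanRow_sum {n : ℕ} (s : Bool) (f g : Fin n → Bool) :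
    (scanRow .sum (some s) (List.ofFn f) (List.ofFn g)).isSome ↔ ∀ i, f i = true → g i = true := by
  induction n generalizing s with
  | zero => simp [scanRow]
  | succ n ih =>
    rw [List.ofFn_succ, List.ofFn_succ, scanRow, Fin.forall_fin_succ]
    cases hf : f 0 <;> cases hg : g 0 <;> cases s <;> simp [rowStep, scanRow_none, ih]

theorem scanRow_max_true {n : ℕ} (f g : Fin n → Bool) :
    scanRow .max (some true) (List.ofFn f) (List.ofFn g) = some true ↔ ∀ i, f i = false := by
  induction n with
  | zero => simp [scanRow]
  | succ n ih =>
    rw [List.ofFn_succ, List.ofFn_succ, scanRow, Fin.forall_fin_succ]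
    cases hf : f 0 <;> cases hg : g 0 <;> simp [rowStep, scanRow_none, ih]

/-- Either the first bit is the unique successor and the rest of the row must be zero
(`scanRow_max_true`), or it is zero and the search goes on. -/
theorem scanRow_max_false {n : ℕ} (f g : Fin n → Bool) :
    scanRow .max (some false) (List.ofFn f) (List.ofFn g) = some true ↔
      ∃ i, g i = true ∧ ∀ j, f j = true ↔ j = i := by
  induction n with
  | zero => simp [scanRow]
  | succ n ih =>
    rw [List.ofFn_succ, List.ofFn_succ, scanRow, Fin.exists_fin_succ]
    simp only [Fin.forall_fin_succ, Fin.succ_ne_zero, Fin.succ_inj, (Fin.succ_ne_zero _).symm]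
    cases hf : f 0 <;> cases hg : g 0 <;> simp [rowStep, scanRow_none, ih, scanRow_max_true]

theorem acceptRow_iff (k : SyncKind) {n : ℕ} (f g : Fin n → Bool) :
    acceptRow k (List.ofFn f) (List.ofFn g) = true ↔
      k.Accepts {i | g i = true} {i | f i = true} := by
  cases k with
  | sum => exact scanRow_sum false f g
  | max =>
    simp only [acceptRow, rowVerdict, beq_iff_eq, scanRow_max_false, SyncKind.Accepts, Set.ext_iff]
    rfl

theorem refine_ofFn (k : SyncKind) {n m : ℕ} (R : Fin n → Fin m → Fin n → Bool)
    (g : Fin n → Bool) :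
    refine k (tableLists R) (List.ofFn g) = List.ofFn fun q =>
      g q && (List.ofFn fun a => List.ofFn (R q a)).any fun bs => acceptRow k bs (List.ofFn g) := by
  apply List.ext_getElem
  · simp [refine, tableLists]
  · intro i h1 h2
    simp [refine, tableLists]

-- `refine` mirrors the recursion that defines `region`: old membership and an accepted row.
open Classical in
theorem iterate_refine_eq (k : SyncKind) {n m : ℕ} (M : MDP (Fin n) (Fin m)) (T : Finset (Fin n))
    (i : ℕ) :
    (refine k (tableLists fun q a q' => decide (q' ∈ M.post q a)))^[i]
      (List.ofFn fun q => decide (q ∈ T)) = List.ofFn fun q => decide (q ∈ M.region T k i) := by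
  induction i with
  | zero => simp [MDP.region]
  | succ i ih =>
    rw [Function.iterate_succ_apply', ih, refine_ofFn]
    congr 1
    funext q
    rw [Bool.eq_iff_iff]
    simp only [Bool.and_eq_true, decide_eq_true_eq, List.any_eq_true, List.mem_ofFn,
      exists_exists_eq_and, acceptRow_iff]
    rfl

theorem answer_ofMDP (k : SyncKind) {n m : ℕ} (M : MDP (Fin n) (Fin m)) (T : Finset (Fin n))
    (d₀ : PMF (Fin n)) :
    answer k (Input.ofMDP M T d₀) = true ↔
      k.Accepts (M.region T k (Nat.card (Fin n))) d₀.support := by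
  classical
  -- The machine refines `n` times before its verdict, and `n` is the number of states, the level
  -- known to be stable.
  rw [Nat.card_fin]
  have h := acceptRow_iff k (fun q => decide (q ∈ d₀.support)) fun q => decide (q ∈ M.region T k n)
  simp only [← iterate_refine_eq, decide_eq_true_eq] at h
  refine Iff.trans (Eq.to_iff ?_) h
  simp only [answer, Input.ofMDP]

end SyncMDP.Machine

open SyncMDP
theorem mainTheorem9 :
    (∀ (Q : Type*) (A : Type*) [Fintype Q] [MeasurableSpace Q] [DiscreteMeasurableSpace Q]
        [Fintype A] [MeasurableSpace A] [DiscreteMeasurableSpace A]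
        (M : MDP Q A) (T : Finset Q),
      -- for `sum_T`, every winning region is the winning region of the safety objective
      (∀ μ ν : Mode, M.winAlways (SyncKind.sum.fn T) μ = M.winEvent (MDP.safe T) ν) ∧
      -- for `max_T`, it is given by infinite paths of deterministic transitions inside `T`
      (∀ μ : Mode, M.winAlways (SyncKind.max.fn T) μ =
        {d₀ | ∃ π : ℕ → Q × A, π ∈ M.paths ∧ d₀ = PMF.pure (π 0).1 ∧
          (∀ i, (π i).1 ∈ T) ∧ ∀ i, M.δ (π i).1 (π i).2 (π (i + 1)).1 = 1}) ∧
      -- pure memoryless strategies suffice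
      (∀ (k : SyncKind) (μ : Mode), ∀ d₀ ∈ M.winAlways (k.fn T) μ,
        ∃ α : Strategy Q A, α.IsPure ∧ α.IsMemoryless ∧
          AlwaysSynchronizing (k.fn T) 1 (M.symbolicOutcome d₀ α))) ∧
    -- the membership problem is solvable in polynomial time
    (∀ (k : SyncKind) (μ : Mode), ∃ D : Input → Bool, PolyTime D ∧
      ∀ (n m : ℕ) (M : MDP (Fin n) (Fin m)) (T : Finset (Fin n)) (d₀ : PMF (Fin n)),
        D (Input.ofMDP M T d₀) = true ↔ d₀ ∈ M.winAlways (k.fn T) μ) := by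
  refine ⟨fun Q A _ _ _ _ _ _ M T => ⟨fun μ ν => ?_, fun μ => ?_, fun k μ d₀ h => ?_⟩,
    fun k μ => ⟨Machine.answer k, Machine.polyTime_answer k, fun n m M T d₀ => ?_⟩⟩
  · ext d₀
    exact (M.mem_winAlways_iff T SyncKind.sum μ d₀).trans (M.mem_winEvent_safe_iff T ν d₀).symm
  · ext d₀
    exact (M.mem_winAlways_iff T SyncKind.max μ d₀).trans (M.exists_path_iff T d₀).symm
  · obtain ⟨α, hp, hm, hα, -⟩ := M.exists_pure_memoryless T k ((M.mem_winAlways_iff T k μ d₀).1 h)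
    exact ⟨α, hp, hm, hα⟩
  · exact (Machine.answer_ofMDP k M T d₀).trans (M.mem_winAlways_iff T k μ d₀).symm
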